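/- Let $d\ge 1$ and let $K\colon\mathbb R^d\to[0,+\infty]$ be Lebesgue measurable, even (that is, $K(-x)=K(x)$ for a.e. $x$), and such that $\int_{\mathbb R^d}K(x)\,|x|\,dx<+\infty$. For $p\in\mathbb R^d$ set $$\sigma_K(p):=\frac12\int_{\mathbb R^d}K(z)\,|z\cdot p|\,dz .$$ Let $B$ be the open unit ball of $\mathbb R^d$ centred at the origin, let $\omega_{d-1}$ be the $(d-1)$-dimensional Lebesgue measure of the unit ball of $\mathbb R^{d-1}$ (with $\omega_0=1$), and for $\varepsilon>0$ and a Lebesgue measurable set $E\subset\mathbb R^d$ with characteristic function $\chi_E$ put $$K_\varepsilon(x):=\frac1{\varepsilon^d}K\Big(\frac x\varepsilon\Big),\qquad J^1_\varepsilon(E;B):=\frac12\int_B\int_B K_\varepsilon(y-x)\,|\chi_E(y)-\chi_E(x)|\,dy\,dx\in[0,+\infty].$$ For a unit vector $\hat p\in\mathbb R^d$ let $H_{\hat p}:=\{x\in\mathbb R^d: x\cdot\hat p>0\}$. Then for every unit vector $\hat p$, $$\sigma_K(\hat p)=\inf\Big\{\liminf_{\varepsilon\to0^+}\frac1{\omega_{d-1}\,\varepsilon}\,J^1_\varepsilon(E_\varepsilon;B)\;:\;E_\varepsilon\to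 H_{\hat p}\ \text{in }L^1(B)\Big\},$$ where the infimum is over all families $(E_\varepsilon)_{\varepsilon>0}$ of Lebesgue measurable subsets of $\mathbb R^d$ such that $\|\chi_{E_\varepsilon}-\chi_{H_{\hat p}}\|_{L^1(B)}\to0$ as $\varepsilon\to0^+$. -/

import Mathlib

open MeasureTheory Filter Topology
open scoped ENNReal

noncomputable section

namespace NonlocalPerimeter

/-- The Euclidean space `ℝ^d`, with its Euclidean norm and its Lebesgue measure `volume`. -/
abbrev Rd (d : ℕ) : Type := EuclideanSpace ℝ (Fin d)

/-- The characteristic function `χ_E` of a set `E ⊆ ℝ^d`. -/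
def chi {d : ℕ} (E : Set (Rd d)) : Rd d → ℝ := E.indicator (fun _ => 1)

/-- The open unit ball `B` of `ℝ^d` centred at the origin. -/
def unitBall (d : ℕ) : Set (Rd d) := Metric.ball 0 1

/-- `ω_k`, the `k`-dimensional Lebesgue measure of the unit ball of `ℝ^k` (so that `ω_0 = 1`). -/
def omega (k : ℕ) : ℝ≥0∞ := volume (unitBall k)

/-- The open halfspace `H_p = {x : x · p > 0}`. -/
def halfspace {d : ℕ} (p : Rd d) : Set (Rd d) := {x | 0 < inner ℝ x p}

/-- The rescaled kernel `K_ε(x) = ε^{-d} K(x / ε)`, meaningful for `ε > 0`. -/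
def rescale {d : ℕ} (K : Rd d → ℝ≥0∞) (ε : ℝ) (x : Rd d) : ℝ≥0∞ :=
  ENNReal.ofReal ((ε ^ d)⁻¹) * K (ε⁻¹ • x)

/-- The interior part of the rescaled nonlocal energy of a function,
`J¹_ε(u; Ω) = ½ ∫_Ω ∫_Ω K_ε(y - x) |u(y) - u(x)| dy dx`, with values in `[0, ∞]`. -/
def J1 {d : ℕ} (K : Rd d → ℝ≥0∞) (ε : ℝ) (u : Rd d → ℝ) (Ω : Set (Rd d)) : ℝ≥0∞ :=
  2⁻¹ * ∫⁻ x in Ω, ∫⁻ y in Ω, rescale K ε (y - x) * ‖u y - u x‖ₑ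

/-- The interior part of the rescaled nonlocal perimeter of a set, `J¹_ε(E; Ω) = J¹_ε(χ_E; Ω)`. -/
def J1Set {d : ℕ} (K : Rd d → ℝ≥0∞) (ε : ℝ) (E Ω : Set (Rd d)) : ℝ≥0∞ :=
  J1 K ε (chi E) Ω

/-- The anisotropic norm `σ_K(p) = ½ ∫ K(z) |z · p| dz`. -/
def sigma {d : ℕ} (K : Rd d → ℝ≥0∞) (p : Rd d) : ℝ≥0∞ :=
  2⁻¹ * ∫⁻ z, K z * ‖(inner ℝ z p : ℝ)‖ₑ

/-- `E_ε → F` in `L¹(Ω)` as `ε → 0⁺`, that is, `‖χ_{E_ε} - χ_F‖_{L¹(Ω)} → 0`. -/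
def TendstoL1 {d : ℕ} (E : ℝ → Set (Rd d)) (F Ω : Set (Rd d)) : Prop :=
  Tendsto (fun ε : ℝ => eLpNorm (chi (E ε) - chi F) 1 (volume.restrict Ω)) (𝓝[>] 0) (𝓝 0)

/-- Families `(E_ε)_{ε > 0}` of Lebesgue measurable subsets of `ℝ^d` that converge to the
halfspace `H_p` in `L¹(B)` as `ε → 0⁺` (the sets with index `ε ≤ 0` are irrelevant). -/
def admissible {d : ℕ} (p : Rd d) : Set (ℝ → Set (Rd d)) :=
  {E | (∀ ε : ℝ, 0 < ε → NullMeasurableSet (E ε) volume) ∧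
    TendstoL1 E (halfspace p) (unitBall d)}

end NonlocalPerimeter

end

noncomputable section

namespace NonlocalPerimeter

/-! Substituting `y = x + ε z` gives `J¹_ε(u; B) = ½ ∫ K(z) V(ε z) dz`, where `V(v)` is the
variation of `u` under the shift by `v` inside `B`. Everything thus reduces to comparing `V(ε z)`
with `ω_{d-1} ε |z · p|` for each `z`.

Upper bound: for the halfspace itself `V(v) ≤ ω_{d-1} |v · p|` (`shiftVariation_halfspace_le`), so
the constant family suffices.

Lower bound: about `t / ε` shifts by `ε z` compose to a shift of size about `t |z|`, which does not
vanish with `ε`. By telescoping, its variation is at most that many times `V(ε z)`; being a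
fixed-scale quantity, it is stable under `L¹` convergence and can be computed on the halfspace
(`enorm_inner_mul_le_shiftVariation`). Letting `ε → 0`, then `t → 0`, bounds the liminf for each
`z`; Fatou's lemma integrates this against `K`. -/

/-- Splitting of `ℝ^{n+1}` along a unit vector `p` and its orthogonal complement. -/
theorem exists_measurePreserving_split {n : ℕ} (p : Rd (n + 1)) (hp : ‖p‖ = 1) :
    ∃ f : Rd (n + 1) → ℝ × Rd n, MeasurePreserving f volume volume ∧
      ∀ x, (f x).1 = inner ℝ x p ∧ ‖x‖ ^ 2 = (f x).1 ^ 2 + ‖(f x).2‖ ^ 2 := by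
  obtain ⟨b, hb⟩ := Orthonormal.exists_orthonormalBasis_extension_of_card_eq (𝕜 := ℝ)
    (E := Rd (n + 1)) (ι := Fin (n + 1)) (by simp) (v := fun _ => p) (s := {0})
    ⟨fun i => by simpa using hp, fun i j hij => absurd (Subsingleton.elim i j) hij⟩
  have hb0 : b 0 = p := hb 0 rfl
  have h1 := b.measurePreserving_repr
  have h2 := PiLp.volume_preserving_ofLp (Fin (n + 1))
  have h3 := volume_preserving_piFinSuccAbove (fun _ : Fin (n + 1) => ℝ) 0
  have h4 := (MeasurePreserving.id (volume : Measure ℝ)).prod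
    (PiLp.volume_preserving_toLp (Fin n))
  refine ⟨_, h4.comp (h3.comp (h2.comp h1)), fun x => ⟨?_, ?_⟩⟩
  · simp [MeasurableEquiv.piFinSuccAbove, OrthonormalBasis.repr_apply_apply, hb0,
      real_inner_comm]
  · rw [← b.repr.norm_map x, EuclideanSpace.real_norm_sq_eq, Fin.sum_univ_succ,
      EuclideanSpace.real_norm_sq_eq]
    simp [MeasurableEquiv.piFinSuccAbove, Fin.tail]

/-! ### Slabs along the boundary of a halfspace -/

theorem omega_ne_zero (k : ℕ) : omega k ≠ 0 :=
  (Metric.measure_ball_pos volume 0 one_pos).ne'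

theorem omega_ne_top (k : ℕ) : omega k ≠ ∞ := measure_ball_lt_top.ne

theorem measurable_chi {d : ℕ} {E : Set (Rd d)} (hE : MeasurableSet E) : Measurable (chi E) :=
  measurable_const.indicator hE

theorem measurableSet_halfspace {d : ℕ} (p : Rd d) : MeasurableSet (halfspace p) :=
  measurableSet_lt measurable_const (by fun_prop)

/-- The points that a translation by `w` carries across the boundary of the halfspace `H_p`. -/
theorem enorm_chi_halfspace_add_sub {d : ℕ} (p w x : Rd d) :
    ‖chi (halfspace p) (x + w) - chi (halfspace p) x‖ₑ =
      {y : Rd d | inner ℝ y p ∈ Set.uIoc 0 (-inner ℝ w p)}.indicator (fun _ => 1) x := by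
  -- The halfspace is open, so the slab is half-open on the matching side for either sign of `w ·
  -- p`; the identity holds at every point.
  simp only [chi, halfspace, Set.indicator_apply, Set.mem_ofPred_eq, inner_add_left,
    Set.mem_uIoc]
  split_ifs <;> first | (exfalso; grind) | simp

theorem volume_slab_inter_ball_le {n : ℕ} (p : Rd (n + 1)) (hp : ‖p‖ = 1) (a : ℝ) :
    volume ({x : Rd (n + 1) | inner ℝ x p ∈ Set.uIoc 0 a} ∩ unitBall (n + 1)) ≤
      omega n * ‖a‖ₑ := by
  obtain ⟨f, hf, hfx⟩ := exists_measurePreserving_split p hp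
  calc _ ≤ volume (f ⁻¹' (Set.uIoc 0 a ×ˢ Metric.ball (0 : Rd n) 1)) := by
        refine measure_mono fun x hx => ?_
        obtain ⟨h1, h2⟩ := hfx x
        have hx2 : ‖x‖ < 1 := by simpa [unitBall] using hx.2
        refine ⟨by rw [h1]; exact hx.1, ?_⟩
        simp only [mem_ball_zero_iff]
        nlinarith [sq_nonneg (f x).1, norm_nonneg x, norm_nonneg (f x).2]
    _ = omega n * ‖a‖ₑ := by
        rw [hf.measure_preimage (measurableSet_uIoc.prod
          measurableSet_ball).nullMeasurableSet,
          Measure.volume_eq_prod, Measure.prod_prod, Real.volume_uIoc, mul_comm, omega, unitBall,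
          ← Real.enorm_eq_ofReal_abs, sub_zero]

/-- A cylinder of height `|a| ≤ s` over a ball of radius `1 - 2s` fits in the ball of radius `1 -
s`, by the triangle inequality. -/
theorem le_volume_slab_inter_ball {n : ℕ} (p : Rd (n + 1)) (hp : ‖p‖ = 1) {a s : ℝ}
    (has : |a| ≤ s) (hs : s < 1 / 2) :
    omega n * ‖a‖ₑ * ENNReal.ofReal ((1 - 2 * s) ^ n) ≤
      volume ({x : Rd (n + 1) | inner ℝ x p ∈ Set.uIoc 0 a} ∩ Metric.ball 0 (1 - s)) := by
  obtain ⟨f, hf, hfx⟩ := exists_measurePreserving_split p hp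
  calc _ = volume (f ⁻¹' (Set.uIoc 0 a ×ˢ Metric.ball (0 : Rd n) (1 - 2 * s))) := by
        rw [hf.measure_preimage (measurableSet_uIoc.prod
          measurableSet_ball).nullMeasurableSet,
          Measure.volume_eq_prod, Measure.prod_prod, Real.volume_uIoc,
          Measure.addHaar_ball_of_pos _ _ (by linarith), finrank_euclideanSpace_fin,
          ← Real.enorm_eq_ofReal_abs, sub_zero, omega, unitBall]
        ring
    _ ≤ _ := by
        refine measure_mono fun x ⟨hx1, hx2⟩ => ?_
        obtain ⟨h1, h2⟩ := hfx x
        refine ⟨by rw [Set.mem_ofPred_eq, ← h1]; exact hx1, ?_⟩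
        simp only [mem_ball_zero_iff] at hx2 ⊢
        have hb : |(f x).1| ≤ s := by
          have : |(f x).1| ≤ |a| := by
            simpa using Set.abs_sub_left_of_mem_uIcc (Set.uIoc_subset_uIcc hx1)
          exact this.trans has
        have h3 := abs_nonneg (f x).1
        rw [← sq_abs (f x).1] at h2
        have : ‖x‖ ≤ |(f x).1| + ‖(f x).2‖ := by
          refine abs_le_of_sq_le_sq' ?_ (by positivity) |>.2
          nlinarith [norm_nonneg (f x).2]
        linarith

/-! ### The energy as an average of shift variations -/

/-- The increment `|u(x + v) - u(x)|`, for `x` and `x + v` in the unit ball, and `0` otherwise. -/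
def shiftIncrement {d : ℕ} (u : Rd d → ℝ) (v : Rd d) : Rd d → ℝ≥0∞ :=
  (unitBall d ∩ (· + v) ⁻¹' unitBall d).indicator (fun x => ‖u (x + v) - u x‖ₑ)

/-- The variation of `u` under the translation by `v`, computed inside the unit ball:
`∫_{B ∩ (B - v)} |u(x + v) - u(x)| dx`. -/
def shiftVariation {d : ℕ} (u : Rd d → ℝ) (v : Rd d) : ℝ≥0∞ :=
  ∫⁻ x, shiftIncrement u v x

theorem shiftIncrement_of_mem {d : ℕ} (u : Rd d → ℝ) {v x : Rd d} (hx : x ∈ unitBall d)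
    (hxv : x + v ∈ unitBall d) : shiftIncrement u v x = ‖u (x + v) - u x‖ₑ :=
  Set.indicator_of_mem (Set.mem_inter hx hxv) _

theorem shiftIncrement_of_notMem_left {d : ℕ} (u : Rd d → ℝ) {v x : Rd d} (hx : x ∉ unitBall d) :
    shiftIncrement u v x = 0 :=
  Set.indicator_of_notMem (fun h => hx h.1) _

theorem shiftIncrement_of_notMem_right {d : ℕ} (u : Rd d → ℝ) {v x : Rd d}
    (hx : x + v ∉ unitBall d) : shiftIncrement u v x = 0 :=
  Set.indicator_of_notMem (fun h => hx h.2) _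

theorem measurable_uncurry_shiftIncrement {d : ℕ} {u : Rd d → ℝ} (hu : Measurable u) :
    Measurable fun q : Rd d × Rd d => shiftIncrement u q.1 q.2 := by
  have hB : MeasurableSet (unitBall d) := measurableSet_ball
  have hadd : Measurable fun q : Rd d × Rd d => q.2 + q.1 := by fun_prop
  have : (fun q : Rd d × Rd d => shiftIncrement u q.1 q.2) =
      (Prod.snd ⁻¹' unitBall d ∩ (fun q : Rd d × Rd d => q.2 + q.1) ⁻¹' unitBall d).indicator
        (fun q => ‖u (q.2 + q.1) - u q.2‖ₑ) := rfl
  rw [this]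
  exact Measurable.indicator (by fun_prop) ((measurable_snd hB).inter (hadd hB))

theorem measurable_shiftIncrement {d : ℕ} {u : Rd d → ℝ} (hu : Measurable u) (v : Rd d) :
    Measurable (shiftIncrement u v) := by
  have hB : MeasurableSet (unitBall d) := measurableSet_ball
  exact Measurable.indicator (by fun_prop) (hB.inter (measurable_add_const v hB))

theorem measurable_shiftVariation {d : ℕ} {u : Rd d → ℝ} (hu : Measurable u) :
    Measurable (shiftVariation u) :=
  (measurable_uncurry_shiftIncrement hu).lintegral_prod_right'

theorem lintegral_comp_add_smul {d : ℕ} (f : Rd d → ℝ≥0∞) (x : Rd d) {ε : ℝ} (hε : 0 < ε) :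
    ∫⁻ y, f y = ENNReal.ofReal (ε ^ d) * ∫⁻ z, f (x + ε • z) := by
  rw [← lintegral_add_left_eq_self f x]
  have h := lintegral_map_equiv (μ := volume) (fun y => f (x + y))
    (Homeomorph.smul (α := Rd d) (isUnit_iff_ne_zero.2 hε.ne').unit).toMeasurableEquiv
  have h' : (Homeomorph.smul (α := Rd d) (isUnit_iff_ne_zero.2 hε.ne').unit).toMeasurableEquiv
    = (fun z : Rd d => ε • z) := rfl
  simp only [h'] at h
  rw [Measure.map_addHaar_smul _ hε.ne', lintegral_smul_measure] at h
  rw [← h, finrank_euclideanSpace_fin, smul_eq_mul, ← mul_assoc,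
    ← ENNReal.ofReal_mul (by positivity), abs_of_pos (by positivity),
    mul_inv_cancel₀ (by positivity), ENNReal.ofReal_one, one_mul]

theorem J1_eq_lintegral_shiftVariation {d : ℕ} {K : Rd d → ℝ≥0∞} (hK : Measurable K)
    {u : Rd d → ℝ} (hu : Measurable u) {ε : ℝ} (hε : 0 < ε) :
    J1 K ε u (unitBall d) = 2⁻¹ * ∫⁻ z, K z * shiftVariation u (ε • z) := by
  have hB : MeasurableSet (unitBall d) := measurableSet_ball
  have hm : Measurable fun q : Rd d × Rd d => K q.2 * shiftIncrement u (ε • q.2) q.1 := by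
    have h : Measurable fun q : Rd d × Rd d => (ε • q.2, q.1) := by fun_prop
    have h' := (measurable_uncurry_shiftIncrement hu).comp h
    simp only [Function.comp_def] at h'
    exact (hK.comp measurable_snd).mul h'
  have hinner : ∀ x, (unitBall d).indicator
      (fun x => ∫⁻ y in unitBall d, rescale K ε (y - x) * ‖u y - u x‖ₑ) x =
        ∫⁻ z, K z * shiftIncrement u (ε • z) x := by
    intro x
    by_cases hx : x ∈ unitBall d
    · rw [Set.indicator_of_mem hx, ← lintegral_indicator hB, lintegral_comp_add_smul _ x hε,
        ← lintegral_const_mul' _ _ ENNReal.ofReal_ne_top]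
      refine lintegral_congr fun z => ?_
      by_cases hz : x + ε • z ∈ unitBall d
      · rw [Set.indicator_of_mem hz, shiftIncrement_of_mem u hx hz, rescale, add_sub_cancel_left,
          inv_smul_smul₀ hε.ne', ← mul_assoc, ← mul_assoc, ← ENNReal.ofReal_mul (by positivity),
          mul_inv_cancel₀ (by positivity), ENNReal.ofReal_one, one_mul]
      · rw [Set.indicator_of_notMem hz, shiftIncrement_of_notMem_right u hz, mul_zero, mul_zero]
    · simp [Set.indicator_of_notMem hx, shiftIncrement_of_notMem_left u hx]
  rw [J1, ← lintegral_indicator hB, lintegral_congr hinner,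
    lintegral_lintegral_swap hm.aemeasurable]
  congr 1
  refine lintegral_congr fun z => ?_
  rw [lintegral_const_mul _ (measurable_shiftIncrement hu _), shiftVariation]

/-- Changing the kernel and the function on null sets does not change the energy. -/
theorem J1_congr_ae {d : ℕ} {K K' : Rd d → ℝ≥0∞} (hK : K =ᵐ[volume] K') {u u' : Rd d → ℝ}
    (hu : u =ᵐ[volume] u') {ε : ℝ} (hε : 0 < ε) (Ω : Set (Rd d)) :
    J1 K ε u Ω = J1 K' ε u' Ω := by
  unfold J1
  congr 1
  refine lintegral_congr_ae (ae_restrict_of_ae ?_)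
  filter_upwards [hu] with x hx
  -- For fixed `x`, null sets of the kernel variable pull back to null sets in `y`.
  have hq : Measure.QuasiMeasurePreserving (fun y : Rd d => ε⁻¹ • (y - x)) volume volume :=
    (Measure.quasiMeasurePreserving_smul volume (inv_ne_zero hε.ne')).comp
      (measurePreserving_sub_right volume x).quasiMeasurePreserving
  refine lintegral_congr_ae (ae_restrict_of_ae ?_)
  filter_upwards [hu, hq.ae hK] with y hy hKy
  rw [rescale, rescale, hKy, hx, hy]

/-! ### Estimates for a single direction -/

theorem shiftVariation_halfspace_le {n : ℕ} (p : Rd (n + 1)) (hp : ‖p‖ = 1) (v : Rd (n + 1)) :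
    shiftVariation (chi (halfspace p)) v ≤ omega n * ‖(inner ℝ v p : ℝ)‖ₑ := by
  have hm : MeasurableSet {x : Rd (n + 1) | inner ℝ x p ∈ Set.uIoc 0 (-inner ℝ v p)} :=
    (by fun_prop : Measurable fun x : Rd (n + 1) => (inner ℝ x p : ℝ)) measurableSet_uIoc
  have hB : MeasurableSet (unitBall (n + 1)) := measurableSet_ball
  have h := volume_slab_inter_ball_le p hp (-inner ℝ v p)
  rw [enorm_neg, ← lintegral_indicator_one (hm.inter hB)] at h
  refine (lintegral_mono fun x => ?_).trans h
  simp only [shiftIncrement, enorm_chi_halfspace_add_sub]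
  rw [Set.indicator_indicator]
  refine Set.indicator_le_indicator_of_subset ?_ (fun _ => zero_le) x
  exact fun y hy => ⟨hy.2, hy.1.1⟩

/-- A shift by `n • v` is controlled by `n` times the shift by `v`, away from the boundary. -/
theorem lintegral_ball_enorm_add_nsmul_sub_le {d : ℕ} {u : Rd d → ℝ} (hu : Measurable u)
    (v : Rd d) (n : ℕ) {s : ℝ} (hs : n * ‖v‖ ≤ s) :
    ∫⁻ x in Metric.ball 0 (1 - s), ‖u (x + n • v) - u x‖ₑ ≤ n * shiftVariation u v := by
  set F : Rd d → ℝ≥0∞ := shiftIncrement u v with hF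
  have hFm : Measurable F := measurable_shiftIncrement hu v
  calc _ ≤ ∫⁻ x in Metric.ball 0 (1 - s), ∑ k ∈ Finset.range n, F (x + k • v) := by
        refine setLIntegral_mono' measurableSet_ball fun x hx => ?_
        rw [mem_ball_zero_iff] at hx
        have htel : u (x + n • v) - u x =
            ∑ k ∈ Finset.range n, (u (x + (k + 1) • v) - u (x + k • v)) := by
          rw [Finset.sum_range_sub (fun k => u (x + k • v))]; simp
        rw [htel]
        refine (enorm_sum_le _ _).trans (Finset.sum_le_sum fun k hk => ?_)
        -- All intermediate points stay in `B`, so no increment is cut off.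
        have hmem : ∀ j ≤ n, x + j • v ∈ unitBall d := fun j hj => by
          rw [unitBall, mem_ball_zero_iff]
          have h1 : ‖j • v‖ ≤ j * ‖v‖ := norm_nsmul_le
          have h2 : (j : ℝ) * ‖v‖ ≤ n * ‖v‖ := by gcongr
          linarith [norm_add_le x (j • v)]
        have hk := Finset.mem_range.1 hk
        have hk' : x + k • v + v ∈ unitBall d := by
          simpa [add_assoc, succ_nsmul] using hmem (k + 1) hk
        rw [hF, shiftIncrement_of_mem u (hmem k hk.le) hk', succ_nsmul, add_assoc]
    _ ≤ ∫⁻ x, ∑ k ∈ Finset.range n, F (x + k • v) := setLIntegral_le_lintegral _ _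
    _ = ∑ k ∈ Finset.range n, ∫⁻ x, F (x + k • v) :=
        lintegral_finsetSum _ fun k _ => hFm.comp (measurable_add_const _)
    _ = n * shiftVariation u v := by
        simp only [lintegral_add_right_eq_self F]
        simp [shiftVariation, hF]

/-- Both `x` and `x + w` lie in `B`, and each contributes the `L¹(B)` distance once. -/
theorem lintegral_ball_enorm_add_sub_le {d : ℕ} {u h : Rd d → ℝ} (hu : Measurable u)
    (hh : Measurable h) {w : Rd d} {s : ℝ} (hs : ‖w‖ ≤ s) :
    ∫⁻ x in Metric.ball 0 (1 - s), ‖h (x + w) - h x‖ₑ ≤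
      (∫⁻ x in Metric.ball 0 (1 - s), ‖u (x + w) - u x‖ₑ) +
        2 * eLpNorm (u - h) 1 (volume.restrict (unitBall d)) := by
  have hB : MeasurableSet (unitBall d) := measurableSet_ball
  set G : Rd d → ℝ≥0∞ := (unitBall d).indicator fun x => ‖u x - h x‖ₑ with hG
  have hGm : Measurable G := Measurable.indicator (by fun_prop) hB
  have hGi : ∫⁻ x, G x = eLpNorm (u - h) 1 (volume.restrict (unitBall d)) := by
    rw [eLpNorm_one_eq_lintegral_enorm, hG, lintegral_indicator hB]; rfl
  have hs0 : 0 ≤ s := (norm_nonneg w).trans hs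
  calc _ ≤ ∫⁻ x in Metric.ball 0 (1 - s), (‖u (x + w) - u x‖ₑ + (G (x + w) + G x)) := by
        refine setLIntegral_mono' measurableSet_ball fun x hx => ?_
        rw [mem_ball_zero_iff] at hx
        have h1 : x ∈ unitBall d := by rw [unitBall, mem_ball_zero_iff]; linarith
        have h2 : x + w ∈ unitBall d := by
          rw [unitBall, mem_ball_zero_iff]; linarith [norm_add_le x w]
        rw [hG, Set.indicator_of_mem h1, Set.indicator_of_mem h2,
          ← enorm_neg (u (x + w) - h (x + w))]
        have h3 : h (x + w) - h x =
          (u (x + w) - u x) + (-(u (x + w) - h (x + w)) + (u x - h x)) := by ring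
        rw [h3]
        exact (enorm_add_le _ _).trans (by gcongr; exact enorm_add_le _ _)
    _ = (∫⁻ x in Metric.ball 0 (1 - s), ‖u (x + w) - u x‖ₑ) +
          ∫⁻ x in Metric.ball 0 (1 - s), (G (x + w) + G x) :=
        lintegral_add_right _ (by fun_prop)
    _ ≤ (∫⁻ x in Metric.ball 0 (1 - s), ‖u (x + w) - u x‖ₑ) + ∫⁻ x, (G (x + w) + G x) := by
        gcongr; exact Measure.restrict_le_self
    _ = _ := by
        rw [lintegral_add_right _ hGm, lintegral_add_right_eq_self G, hGi, two_mul]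

theorem le_lintegral_ball_halfspace {n : ℕ} (p : Rd (n + 1)) (hp : ‖p‖ = 1) {w : Rd (n + 1)}
    {s : ℝ} (hw : ‖w‖ ≤ s) (hs : s < 1 / 2) :
    omega n * ‖(inner ℝ w p : ℝ)‖ₑ * ENNReal.ofReal ((1 - 2 * s) ^ n) ≤
      ∫⁻ x in Metric.ball 0 (1 - s), ‖chi (halfspace p) (x + w) - chi (halfspace p) x‖ₑ := by
  have hm : MeasurableSet {x : Rd (n + 1) | inner ℝ x p ∈ Set.uIoc 0 (-inner ℝ w p)} :=
    (by fun_prop : Measurable fun x : Rd (n + 1) => (inner ℝ x p : ℝ)) measurableSet_uIoc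
  have ha : |-(inner ℝ w p : ℝ)| ≤ s := by
    rw [abs_neg]
    exact (abs_real_inner_le_norm w p).trans (by rwa [hp, mul_one])
  have h := le_volume_slab_inter_ball p hp ha hs
  rw [enorm_neg] at h
  refine h.trans_eq ?_
  simp only [enorm_chi_halfspace_add_sub]
  rw [lintegral_indicator hm, setLIntegral_one, Measure.restrict_apply hm]

theorem enorm_inner_mul_le_shiftVariation {n : ℕ} (p : Rd (n + 1)) (hp : ‖p‖ = 1)
    {u : Rd (n + 1) → ℝ} (hu : Measurable u) (z : Rd (n + 1)) {t ε : ℝ} (hε : 0 < ε)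
    (hεt : ε < t) (htz : 4 * t * ‖z‖ < 1) :
    ‖(inner ℝ z p : ℝ)‖ₑ * ENNReal.ofReal ((1 - 4 * t * ‖z‖) ^ n) ≤
      (omega n * ENNReal.ofReal ε)⁻¹ * shiftVariation u (ε • z) +
        (omega n * ENNReal.ofReal t)⁻¹ * (2 * eLpNorm (u - chi (halfspace p)) 1
          (volume.restrict (unitBall (n + 1)))) := by
  -- Rounding up gives `t ≤ N ε`, and `ε < t` gives `N ε ≤ 2t`. The margin is then `s = 2t‖z‖`,
  -- whence the factor `1 - 2s = 1 - 4t‖z‖`.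
  have ht : 0 < t := hε.trans hεt
  set N : ℕ := ⌈t / ε⌉₊ with hN
  have hN1 : t ≤ N * ε := (div_le_iff₀ hε).1 (Nat.le_ceil _)
  have hN2 : N * ε ≤ 2 * t := by
    have h := Nat.ceil_lt_add_one (div_pos ht hε).le
    rw [← hN, div_add_one hε.ne', lt_div_iff₀ hε] at h
    linarith
  have hN0 : (N : ℝ≥0∞) ≠ 0 := by
    rw [Nat.cast_ne_zero]; exact (Nat.ceil_pos.2 (div_pos ht hε)).ne'
  have hNs : N * ‖ε • z‖ ≤ 2 * t * ‖z‖ := by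
    rw [norm_smul, Real.norm_of_nonneg hε.le, ← mul_assoc]
    gcongr
  have hw : ‖N • (ε • z)‖ ≤ 2 * t * ‖z‖ := norm_nsmul_le.trans hNs
  have h1 := le_lintegral_ball_halfspace p hp hw (by linarith)
  have h2 := lintegral_ball_enorm_add_sub_le hu (measurable_chi (measurableSet_halfspace p)) hw
  have h3 := lintegral_ball_enorm_add_nsmul_sub_le hu (ε • z) N hNs
  set δ := eLpNorm (u - chi (halfspace p)) 1 (volume.restrict (unitBall (n + 1)))
  have h4 := h1.trans (h2.trans (add_le_add_left h3 (2 * δ)))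
  have hin : ‖(inner ℝ (N • (ε • z)) p : ℝ)‖ₑ =
      ENNReal.ofReal (N * ε) * ‖(inner ℝ z p : ℝ)‖ₑ := by
    rw [← Nat.cast_smul_eq_nsmul ℝ, smul_smul, real_inner_smul_left, enorm_mul,
      Real.enorm_of_nonneg (by positivity)]
  set A : ℝ≥0∞ := omega n * ENNReal.ofReal (N * ε) with hA
  have hA0 : A ≠ 0 := mul_ne_zero (omega_ne_zero n) (ENNReal.ofReal_pos.2 (by linarith)).ne'
  have hAt : A ≠ ∞ := ENNReal.mul_ne_top (omega_ne_top n) ENNReal.ofReal_ne_top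
  have hA' : A⁻¹ * N = (omega n * ENNReal.ofReal ε)⁻¹ := by
    have : A = N * (omega n * ENNReal.ofReal ε) := by
      rw [hA, ENNReal.ofReal_mul (by positivity), ENNReal.ofReal_natCast]; ring
    rw [this, ENNReal.mul_inv (.inl hN0) (.inl (ENNReal.natCast_ne_top N)), mul_comm, ← mul_assoc,
      ENNReal.mul_inv_cancel hN0 (ENNReal.natCast_ne_top N), one_mul]
  calc _ = A⁻¹ * (omega n * ‖(inner ℝ (N • (ε • z)) p : ℝ)‖ₑ *
        ENNReal.ofReal ((1 - 2 * (2 * t * ‖z‖)) ^ n)) := by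
        rw [hin, ← mul_assoc (omega n), ← hA, ← mul_assoc, ← mul_assoc,
          ENNReal.inv_mul_cancel hA0 hAt, one_mul]
        congr 4; ring
    _ ≤ A⁻¹ * (N * shiftVariation u (ε • z) + 2 * δ) := by gcongr
    _ = (omega n * ENNReal.ofReal ε)⁻¹ * shiftVariation u (ε • z) + A⁻¹ * (2 * δ) := by
        rw [mul_add, ← mul_assoc, hA']
    -- Since `t ≤ N ε`, the error coefficient is bounded independently of `ε`.
    _ ≤ _ := by
        rw [hA]
        gcongr

/-- Lower semicontinuity of the directional difference quotients at a halfspace. -/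
theorem enorm_inner_le_liminf_shiftVariation {n : ℕ} (p : Rd (n + 1)) (hp : ‖p‖ = 1)
    {E : ℝ → Set (Rd (n + 1))} (hE : ∀ ε, MeasurableSet (E ε))
    (hL : TendstoL1 E (halfspace p) (unitBall (n + 1))) (z : Rd (n + 1)) :
    ‖(inner ℝ z p : ℝ)‖ₑ ≤ liminf (fun ε : ℝ =>
      (omega n * ENNReal.ofReal ε)⁻¹ * shiftVariation (chi (E ε)) (ε • z)) (𝓝[>] 0) := by
  have key : ∀ t : ℝ, 0 < t → 4 * t * ‖z‖ < 1 →
      ‖(inner ℝ z p : ℝ)‖ₑ * ENNReal.ofReal ((1 - 4 * t * ‖z‖) ^ n) ≤ liminf (fun ε : ℝ =>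
        (omega n * ENNReal.ofReal ε)⁻¹ * shiftVariation (chi (E ε)) (ε • z)) (𝓝[>] 0) := by
    intro t ht htz
    have h0 : Tendsto (fun ε => (omega n * ENNReal.ofReal t)⁻¹ * (2 * eLpNorm (chi (E ε) -
        chi (halfspace p)) 1 (volume.restrict (unitBall (n + 1))))) (𝓝[>] 0) (𝓝 0) := by
      have hc : (omega n * ENNReal.ofReal t)⁻¹ ≠ ∞ :=
        ENNReal.inv_ne_top.2 (mul_ne_zero (omega_ne_zero n) (ENNReal.ofReal_pos.2 ht).ne')
      simpa using ENNReal.Tendsto.const_mul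
        (ENNReal.Tendsto.const_mul hL (.inr ENNReal.ofNat_ne_top)) (.inr hc)
    rw [← ENNReal.liminf_add_of_right_tendsto_zero h0]
    refine le_liminf_of_le (by isBoundedDefault) ?_
    filter_upwards [Ioo_mem_nhdsGT ht] with ε hε
    exact enorm_inner_mul_le_shiftVariation p hp (measurable_chi (hE ε)) z hε.1 hε.2 htz
  have hcont : Tendsto (fun t : ℝ => ‖(inner ℝ z p : ℝ)‖ₑ *
      ENNReal.ofReal ((1 - 4 * t * ‖z‖) ^ n)) (𝓝[>] 0) (𝓝 (‖(inner ℝ z p : ℝ)‖ₑ * 1)) := by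
    refine ENNReal.Tendsto.const_mul ?_ (.inr enorm_ne_top)
    have : Continuous fun t : ℝ => ENNReal.ofReal ((1 - 4 * t * ‖z‖) ^ n) :=
      ENNReal.continuous_ofReal.comp (by fun_prop)
    simpa using (this.tendsto 0).mono_left nhdsWithin_le_nhds
  rw [mul_one] at hcont
  refine le_of_tendsto hcont ?_
  have hev : ∀ᶠ t : ℝ in 𝓝[>] 0, 4 * t * ‖z‖ < 1 := by
    have : Continuous fun t : ℝ => 4 * t * ‖z‖ := by fun_prop
    exact nhdsWithin_le_nhds (this.continuousAt.eventually_lt continuousAt_const (by simp))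
  filter_upwards [hev, self_mem_nhdsWithin] with t ht ht0
  exact key t ht0 ht

/-! ### The liminf inequality -/

theorem sigma_le_liminf_of_measurable {n : ℕ} {K : Rd (n + 1) → ℝ≥0∞} (hK : Measurable K)
    (p : Rd (n + 1)) (hp : ‖p‖ = 1) {E : ℝ → Set (Rd (n + 1))} (hE : ∀ ε, MeasurableSet (E ε))
    (hL : TendstoL1 E (halfspace p) (unitBall (n + 1))) :
    sigma K p ≤ liminf (fun ε : ℝ => (omega n * ENNReal.ofReal ε)⁻¹ *
      J1Set K ε (E ε) (unitBall (n + 1))) (𝓝[>] 0) := by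
  set q : ℝ → Rd (n + 1) → ℝ≥0∞ := fun ε z =>
    (omega n * ENNReal.ofReal ε)⁻¹ * shiftVariation (chi (E ε)) (ε • z)
  have hq : ∀ ε, Measurable (q ε) := fun ε =>
    ((measurable_shiftVariation (measurable_chi (hE ε))).comp
      (measurable_const_smul ε)).const_mul _
  have hJ : ∀ᶠ ε : ℝ in 𝓝[>] 0, 2⁻¹ * ∫⁻ z, K z * q ε z =
      (omega n * ENNReal.ofReal ε)⁻¹ * J1Set K ε (E ε) (unitBall (n + 1)) := by
    filter_upwards [self_mem_nhdsWithin] with ε hε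
    have hε : 0 < ε := hε
    rw [J1Set, J1_eq_lintegral_shiftVariation hK (measurable_chi (hE ε)) hε, mul_left_comm,
      ← lintegral_const_mul' (omega n * ENNReal.ofReal ε)⁻¹ _ (ENNReal.inv_ne_top.2
        (mul_ne_zero (omega_ne_zero n) (ENNReal.ofReal_pos.2 hε).ne'))]
    congr 1
    exact lintegral_congr fun z => mul_left_comm _ _ _
  rw [← liminf_congr hJ]
  have hconst : ∀ (c : ℝ≥0∞) (g : ℝ → ℝ≥0∞),
      c * liminf g (𝓝[>] 0) ≤ liminf (fun ε => c * g ε) (𝓝[>] 0) := fun c g => by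
    simpa [Pi.mul_def] using
      ENNReal.le_liminf_mul (u := fun _ : ℝ => c) (v := g) (f := 𝓝[>] (0 : ℝ))
  calc sigma K p ≤ 2⁻¹ * ∫⁻ z, liminf (fun ε => K z * q ε z) (𝓝[>] 0) := by
        unfold sigma
        gcongr with z
        refine le_trans ?_ (hconst _ _)
        gcongr
        exact enorm_inner_le_liminf_shiftVariation p hp hE hL z
    _ ≤ 2⁻¹ * liminf (fun ε => ∫⁻ z, K z * q ε z) (𝓝[>] 0) := by
        gcongr
        exact lintegral_liminf_le fun ε => hK.mul (hq ε)
    _ ≤ _ := hconst _ _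

theorem chi_ae_eq {d : ℕ} {E F : Set (Rd d)} (h : E =ᵐ[volume] F) :
    chi E =ᵐ[volume] chi F :=
  indicator_ae_eq_of_ae_eq_set h

theorem sigma_congr_ae {d : ℕ} {K K' : Rd d → ℝ≥0∞} (h : K =ᵐ[volume] K') (p : Rd d) :
    sigma K p = sigma K' p := by
  unfold sigma
  congr 1
  refine lintegral_congr_ae ?_
  filter_upwards [h] with z hz
  rw [hz]

theorem sigma_le_liminf {n : ℕ} {K : Rd (n + 1) → ℝ≥0∞} (hK : AEMeasurable K volume)
    (p : Rd (n + 1)) (hp : ‖p‖ = 1) {E : ℝ → Set (Rd (n + 1))} (hE : E ∈ admissible p) :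
    sigma K p ≤ liminf (fun ε : ℝ => (omega n * ENNReal.ofReal ε)⁻¹ *
      J1Set K ε (E ε) (unitBall (n + 1))) (𝓝[>] 0) := by
  -- `toMeasurable` is measurable at every index, even for `ε ≤ 0` where `E ε` is arbitrary;
  -- agreement a.e. is needed only for `ε > 0`.
  have hae : ∀ᶠ ε : ℝ in 𝓝[>] 0, chi (E ε) =ᵐ[volume] chi (toMeasurable volume (E ε)) := by
    filter_upwards [self_mem_nhdsWithin] with ε hε
    exact chi_ae_eq (hE.1 ε hε).toMeasurable_ae_eq.symm
  have hL : TendstoL1 (fun ε => toMeasurable volume (E ε)) (halfspace p) (unitBall (n + 1)) := by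
    refine hE.2.congr' ?_
    filter_upwards [hae] with ε hε
    exact eLpNorm_congr_ae (ae_restrict_of_ae (hε.sub (ae_eq_refl _)))
  rw [sigma_congr_ae hK.ae_eq_mk]
  refine (sigma_le_liminf_of_measurable hK.measurable_mk p hp
    (fun ε => measurableSet_toMeasurable _ _) hL).trans_eq (liminf_congr ?_)
  filter_upwards [hae, self_mem_nhdsWithin] with ε hε hε0
  rw [J1Set, J1Set, J1_congr_ae hK.ae_eq_mk hε hε0]

/-! ### The constant family attains the bound -/

theorem const_halfspace_mem_admissible {d : ℕ} (p : Rd d) :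
    (fun _ : ℝ => halfspace p) ∈ admissible p :=
  ⟨fun _ _ => (measurableSet_halfspace p).nullMeasurableSet, by simp [TendstoL1]⟩

theorem J1Set_halfspace_le {n : ℕ} {K : Rd (n + 1) → ℝ≥0∞} (hK : AEMeasurable K volume)
    (p : Rd (n + 1)) (hp : ‖p‖ = 1) {ε : ℝ} (hε : 0 < ε) :
    (omega n * ENNReal.ofReal ε)⁻¹ * J1Set K ε (halfspace p) (unitBall (n + 1)) ≤ sigma K p := by
  set A : ℝ≥0∞ := omega n * ENNReal.ofReal ε with hA
  have hA0 : A ≠ 0 := mul_ne_zero (omega_ne_zero n) (ENNReal.ofReal_pos.2 hε).ne'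
  have hAt : A ≠ ∞ := ENNReal.mul_ne_top (omega_ne_top n) ENNReal.ofReal_ne_top
  rw [J1Set, J1_congr_ae hK.ae_eq_mk (ae_eq_refl _) hε,
    J1_eq_lintegral_shiftVariation hK.measurable_mk (measurable_chi (measurableSet_halfspace p)) hε,
    sigma_congr_ae hK.ae_eq_mk, sigma, mul_left_comm,
    ← lintegral_const_mul' _ _ (ENNReal.inv_ne_top.2 hA0)]
  refine mul_le_mul_right (lintegral_mono fun z => ?_) _
  calc _ ≤ A⁻¹ * (hK.mk K z * (omega n * ‖(inner ℝ (ε • z) p : ℝ)‖ₑ)) := by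
        gcongr
        exact shiftVariation_halfspace_le p hp _
    _ = A⁻¹ * A * (hK.mk K z * ‖(inner ℝ z p : ℝ)‖ₑ) := by
        rw [real_inner_smul_left, enorm_mul, Real.enorm_of_nonneg hε.le, hA]; ring
    _ = _ := by rw [ENNReal.inv_mul_cancel hA0 hAt, one_mul]

end NonlocalPerimeter

end

theorem lemma3p5 {d : ℕ} (K : NonlocalPerimeter.Rd d → ℝ≥0∞)
    (hK_meas : AEMeasurable K volume)
    (hK_even : ∀ᵐ x ∂(volume : Measure (NonlocalPerimeter.Rd d)), K (-x) = K x)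
    (hK_moment : ∫⁻ x, K x * ‖x‖ₑ < ∞)
    (p : NonlocalPerimeter.Rd d) (hp : ‖p‖ = 1) :
    NonlocalPerimeter.sigma K p =
      sInf {l : ℝ≥0∞ | ∃ E ∈ NonlocalPerimeter.admissible p,
        l = liminf (fun ε : ℝ =>
          (NonlocalPerimeter.omega (d - 1) * ENNReal.ofReal ε)⁻¹ *
            NonlocalPerimeter.J1Set K ε (E ε) (NonlocalPerimeter.unitBall d)) (𝓝[>] 0)} := by
  obtain _ | n := d
  -- In dimension zero there is no unit vector.
  · rw [Subsingleton.elim p 0, norm_zero] at hp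
    exact absurd hp zero_ne_one
  rw [Nat.add_sub_cancel]
  refine le_antisymm (le_sInf ?_) ?_
  · rintro _ ⟨E, hE, rfl⟩
    exact NonlocalPerimeter.sigma_le_liminf hK_meas p hp hE
  · refine sInf_le_of_le
      (Set.mem_ofPred.2 ⟨_, NonlocalPerimeter.const_halfspace_mem_admissible p, rfl⟩) ?_
    refine liminf_le_of_frequently_le' (Eventually.frequently ?_)
    filter_upwards [self_mem_nhdsWithin] with ε hε
    exact NonlocalPerimeter.J1Set_halfspace_le hK_meas p hp hε
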